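/- A subgroup $G\subseteq GL(n,\mathbb C)$ is called algebraic if it is the set of common zeros in $GL(n,\mathbb C)$ of a set of polynomials in the matrix entries; its Lie algebra is the set of matrices $X$ with $dP_1(X)=0$ for every polynomial $P$ in the ideal $I(G)$ of all polynomials vanishing on $G$ (where $dP_1$ is the differential of $P$ at the identity). A Lie subalgebra of $gl(n,\mathbb C)$ is called algebraic if it is the Lie algebra of an algebraic subgroup of $GL(n,\mathbb C)$. Let $\alpha,\beta\in\mathbb C$ with $\alpha+\beta\neq 0$, let $\mathfrak h\subset gl(4,\mathbb C)$ be the Lie subalgebra of all matrices $$X(x_1,x_2,x_3)=\begin{pmatrix} x_1+x_2 & x_1+x_2 & 0 & x_1\\ x_1+x_2 & x_1+x_2 & 0 & x_2\\ \alpha x_1+(\beta-1)x_2 & \beta x_1+(\alpha+1)x_2 & 0 & x_3\\ 0&0&0&0\end{pmatrix},\qquad x_1,x_2,x_3\in\mathbb C,$$ and let $$X_4=\begin{pmatrix} 1&1&0&\tfrac12\\ 1&1&0&\tfrac12\\ \tfrac{\alpha+\beta}2&\tfrac{\alpha+\beta}2&0&\tfrac{\alpha+\beta}4\\ 0&0&0&0\end{pmatrix},\qquad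 \mathfrak m=\mathfrak h+\mathbb C X_4 .$$ **Proposition.** 1. The Chevalley–Jordan decomposition of $X=X(x_1,x_2,x_3)\in\mathfrak h$ is unique and has semisimple part $(x_1+x_2)X_4$ and nilpotent part $X-(x_1+x_2)X_4$. 2. The sum $\mathfrak m=\mathfrak h\oplus\mathbb C X_4$ is direct, and $\mathfrak m$ is a $4$-dimensional Lie subalgebra of $gl(4,\mathbb C)$. 3. $\mathfrak m$ is algebraic. 4. $\mathfrak m=\mathfrak n_1\oplus\mathfrak a_1$, where the set $\mathfrak n_1$ of nilpotent elements of $\mathfrak m$ is a $3$-dimensional ideal of $\mathfrak m$, and the set $\mathfrak a_1$ of semisimple elements of $\mathfrak m$ is the Lie subalgebra $\mathbb C X_4$, which is central in $\mathfrak m$. 5. $\mathfrak m$ is the smallest algebraic Lie subalgebra of $gl(4,\mathbb C)$ containing $\mathfrak h$: every algebraic Lie subalgebra of $gl(4,\mathbb C)$ that contains $\mathfrak h$ contains $\mathfrak m$. -/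

import Mathlib

attribute [local instance 100] LieRing.ofAssociativeRing

namespace AlgebraicLie

open Matrix

/-- The point of affine `n × n`-space given by a matrix. -/
noncomputable def point {n : ℕ} (X : Matrix (Fin n) (Fin n) ℂ) : Fin n × Fin n → ℂ :=
  fun ij => X ij.1 ij.2

/-- A subgroup of `GL(n, ℂ)` is an algebraic group if it is the set of common zeros in `GL(n, ℂ)`
of a set of polynomials in the matrix entries. -/
def IsAlgebraicGroup {n : ℕ} (G : Subgroup (GL (Fin n) ℂ)) : Prop :=
  ∃ S : Set (MvPolynomial (Fin n × Fin n) ℂ),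
    ∀ g : GL (Fin n) ℂ,
      g ∈ G ↔ ∀ P ∈ S, MvPolynomial.eval (point (g : Matrix (Fin n) (Fin n) ℂ)) P = 0

/-- The ideal `I(G)` of all polynomials in the matrix entries that vanish on `G`. -/
noncomputable def groupIdeal {n : ℕ} (G : Subgroup (GL (Fin n) ℂ)) :
    Ideal (MvPolynomial (Fin n × Fin n) ℂ) :=
  MvPolynomial.vanishingIdeal ℂ
    ((fun g : GL (Fin n) ℂ => point (g : Matrix (Fin n) (Fin n) ℂ)) '' (G : Set (GL (Fin n) ℂ)))

/-- The differential `dP` at the identity matrix, evaluated at `X`. -/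
noncomputable def differentialAtOne {n : ℕ} (P : MvPolynomial (Fin n × Fin n) ℂ)
    (X : Matrix (Fin n) (Fin n) ℂ) : ℂ :=
  ∑ i, ∑ j, MvPolynomial.eval (point (1 : Matrix (Fin n) (Fin n) ℂ))
    (MvPolynomial.pderiv (i, j) P) * X i j

/-- A Lie subalgebra of `gl(n, ℂ)` is algebraic if it is the Lie algebra of an algebraic group `G`,
that is, if it consists of the matrices `X` with `dP(X) = 0` for all `P` in `I(G)`. -/
def IsAlgebraic {n : ℕ} (L : LieSubalgebra ℂ (Matrix (Fin n) (Fin n) ℂ)) : Prop :=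
  ∃ G : Subgroup (GL (Fin n) ℂ), IsAlgebraicGroup G ∧
    ∀ X : Matrix (Fin n) (Fin n) ℂ, X ∈ L ↔ ∀ P ∈ groupIdeal G, differentialAtOne P X = 0

/-- A matrix is semisimple if the endomorphism it defines is (over `ℂ`: diagonalizable). -/
def IsSemisimple {n : ℕ} (X : Matrix (Fin n) (Fin n) ℂ) : Prop :=
  Module.End.IsSemisimple (Matrix.toLin' X)

/-- `X = S + N` is the Chevalley-Jordan decomposition of `X`. -/
def IsJordanDecomposition {n : ℕ} (X S N : Matrix (Fin n) (Fin n) ℂ) : Prop :=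
  X = S + N ∧ IsSemisimple S ∧ IsNilpotent N ∧ Commute S N

/-- The general element of `h`. -/
noncomputable def hMat (α β x₁ x₂ x₃ : ℂ) : Matrix (Fin 4) (Fin 4) ℂ :=
  !![x₁ + x₂, x₁ + x₂, 0, x₁;
     x₁ + x₂, x₁ + x₂, 0, x₂;
     α * x₁ + (β - 1) * x₂, β * x₁ + (α + 1) * x₂, 0, x₃;
     0, 0, 0, 0]

/-- The matrix `X₄`. -/
noncomputable def X₄ (α β : ℂ) : Matrix (Fin 4) (Fin 4) ℂ :=
  !![1, 1, 0, 1 / 2;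
     1, 1, 0, 1 / 2;
     (α + β) / 2, (α + β) / 2, 0, (α + β) / 4;
     0, 0, 0, 0]

theorem hMat_lie (α β x₁ x₂ x₃ y₁ y₂ y₃ : ℂ) :
    ⁅hMat α β x₁ x₂ x₃, hMat α β y₁ y₂ y₃⁆ = hMat α β 0 0 (x₁ * y₂ - x₂ * y₁) := by
  rw [Ring.lie_def]
  ext i j
  fin_cases i <;> fin_cases j <;>
    simp [hMat] <;> ring

theorem hMat_lie_X₄ (α β x₁ x₂ x₃ : ℂ) : ⁅hMat α β x₁ x₂ x₃, X₄ α β⁆ = 0 := by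
  rw [Ring.lie_def]
  ext i j
  fin_cases i <;> fin_cases j <;>
    simp [hMat, X₄] <;> ring

/-- The Lie subalgebra `h` of `gl(4, ℂ)`. -/
noncomputable def h (α β : ℂ) : LieSubalgebra ℂ (Matrix (Fin 4) (Fin 4) ℂ) where
  carrier := {X | ∃ x₁ x₂ x₃ : ℂ, X = hMat α β x₁ x₂ x₃}
  zero_mem' := ⟨0, 0, 0, by
    ext i j; fin_cases i <;> fin_cases j <;> simp [hMat]⟩
  add_mem' := by
    rintro _ _ ⟨x₁, x₂, x₃, rfl⟩ ⟨y₁, y₂, y₃, rfl⟩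
    refine ⟨x₁ + y₁, x₂ + y₂, x₃ + y₃, ?_⟩
    ext i j; fin_cases i <;> fin_cases j <;> simp [hMat] <;> ring
  smul_mem' := by
    rintro c _ ⟨x₁, x₂, x₃, rfl⟩
    refine ⟨c * x₁, c * x₂, c * x₃, ?_⟩
    ext i j; fin_cases i <;> fin_cases j <;> simp [hMat] <;> ring
  lie_mem' := by
    rintro _ _ ⟨x₁, x₂, x₃, rfl⟩ ⟨y₁, y₂, y₃, rfl⟩
    exact ⟨_, _, _, hMat_lie α β x₁ x₂ x₃ y₁ y₂ y₃⟩

/-- The Lie subalgebra `m = h + ℂ X₄` of `gl(4, ℂ)`. -/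
noncomputable def m (α β : ℂ) : LieSubalgebra ℂ (Matrix (Fin 4) (Fin 4) ℂ) :=
  { (h α β).toSubmodule ⊔ Submodule.span ℂ {X₄ α β} with
    lie_mem' := by
      intro X Y hX hY
      obtain ⟨_, ⟨x₁, x₂, x₃, rfl⟩, _, hS, rfl⟩ := Submodule.mem_sup.1 hX
      obtain ⟨_, ⟨y₁, y₂, y₃, rfl⟩, _, hT, rfl⟩ := Submodule.mem_sup.1 hY
      obtain ⟨c, rfl⟩ := Submodule.mem_span_singleton.1 hS
      obtain ⟨d, rfl⟩ := Submodule.mem_span_singleton.1 hT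
      have e : ⁅X₄ α β, hMat α β y₁ y₂ y₃⁆ = 0 := by
        rw [← lie_skew, hMat_lie_X₄, neg_zero]
      refine Submodule.mem_sup_left ⟨0, 0, x₁ * y₂ - x₂ * y₁, ?_⟩
      simp [hMat_lie, hMat_lie_X₄, e] }

end AlgebraicLie

/-! Everything rests on the splitting of `m` into `ℂ X₄` and the three-parameter space of matrices
`nilMat a b c` (`hMat_eq`, `mem_m_iff`). Here `X₄` is twice a projection, it annihilates each
`nilMat` on both sides, and products of `nilMat`s are again `nilMat`s. The Jordan decompositions,
the ideal and the centre are read off from these products.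

They also make `m` closed under matrix multiplication. The invertible matrices in `1 + m` then form
a group cut out by affine equations, with Lie algebra `m` (`isAlgebraic_of_mul_mem`).

For minimality, an algebraic Lie algebra must contain the semisimple part `S` of its element `S + N`
(`IsAlgebraic.semisimple_part_mem`). A matrix `X` lies in the Lie algebra of `G` iff its
left-invariant derivation preserves `I(G)`. The derivation of `S` is diagonalizable, that of `N` is
locally nilpotent, and they commute. On each polynomial the former is therefore a polynomial in the
derivation of `S + N`, so it preserves `I(G)` too. `X₄` is such a semisimple part. -/

namespace AlgebraicLie

open Matrix

/-! ### Commuting semisimple and locally nilpotent endomorphisms; derivations -/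

section Abstract

/-- If `f = s + n` with `s`, `n` commuting and `n` locally nilpotent, then a sum of eigenvectors
of `s` lying in an `f`-stable subspace is mapped into this subspace by `s`. -/
theorem apply_semisimple_mem {V : Type*} [AddCommGroup V] [Module ℂ V] {s n : Module.End ℂ V}
    (hc : Commute s n) (hn : ∀ x, ∃ k : ℕ, (n ^ k) x = 0) {p : Submodule ℂ V}
    (hp : ∀ x ∈ p, (s + n) x ∈ p) {v : V} (hv : v ∈ p)
    (hs : v ∈ ⨆ a, s.eigenspace a) : s v ∈ p := by
  classical
  obtain ⟨w, hw, rfl⟩ := (Submodule.mem_iSup_iff_exists_finsupp _ _).1 hs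
  choose k hk using fun a => hn (w a)
  -- Chinese remainder theorem: `q` is congruent to `a` modulo `(X - a) ^ k a` for each eigenvalue
  -- `a` occurring in `v`, so `q (s + n)` acts on `w a` as the scalar `a`, that is, as `s`.
  have hcop : Pairwise fun a b : w.support =>
      IsCoprime (Ideal.span {(Polynomial.X - Polynomial.C (a : ℂ)) ^ k a})
        (Ideal.span {(Polynomial.X - Polynomial.C (b : ℂ)) ^ k b}) := by
    intro a b hab
    rw [Ideal.isCoprime_span_singleton_iff]
    refine IsCoprime.pow (Polynomial.isCoprime_X_sub_C_of_isUnit_sub ?_)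
    exact (sub_ne_zero.2 fun h => hab (Subtype.ext h)).isUnit
  obtain ⟨q, hq⟩ := Ideal.exists_forall_sub_mem_ideal hcop
    fun a : w.support => Polynomial.C (a : ℂ)
  -- Since `n` preserves the `a`-eigenspace of `s`, the operator `s + n - a` acts there as `n`.
  have hstep : ∀ a (j : ℕ), ((s + n - algebraMap ℂ _ a) ^ j) (w a) = (n ^ j) (w a) := by
    intro a j
    induction j with
    | zero => rfl
    | succ j ih =>
      have h1 : s ((n ^ j) (w a)) = a • (n ^ j) (w a) := by
        rw [← Module.End.mul_apply, (hc.pow_right j).eq, Module.End.mul_apply,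
          Module.End.mem_eigenspace_iff.1 (hw a), map_smul]
      rw [pow_succ', Module.End.mul_apply, ih, pow_succ', Module.End.mul_apply]
      simp [h1, Module.algebraMap_end_apply]
  have hqa : ∀ a : w.support, Polynomial.aeval (s + n) q (w a) = s (w a) := by
    intro a
    obtain ⟨r, hr⟩ := Ideal.mem_span_singleton'.1 (hq a)
    have h1 : Polynomial.aeval (s + n) (q - Polynomial.C (a : ℂ)) (w a) = 0 := by
      rw [← hr, map_mul, Module.End.mul_apply, map_pow, map_sub, Polynomial.aeval_X,
        Polynomial.aeval_C, hstep, hk, map_zero]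
    rw [map_sub, Polynomial.aeval_C, LinearMap.sub_apply, Module.algebraMap_end_apply,
      sub_eq_zero] at h1
    rw [h1, Module.End.mem_eigenspace_iff.1 (hw a)]
  have hsum : s (w.sum fun _ x => x) = Polynomial.aeval (s + n) q (w.sum fun _ x => x) := by
    simp only [Finsupp.sum, map_sum]
    exact Finset.sum_congr rfl fun a ha => (hqa ⟨a, ha⟩).symm
  have hpq : ∀ (q : Polynomial ℂ), ∀ x ∈ p, Polynomial.aeval (s + n) q x ∈ p := by
    intro q
    induction q using Polynomial.induction_on' with
    | add q₁ q₂ h₁ h₂ =>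
      intro x hx
      rw [map_add, LinearMap.add_apply]
      exact p.add_mem (h₁ x hx) (h₂ x hx)
    | monomial i c =>
      intro x hx
      rw [Polynomial.aeval_monomial, Module.End.mul_apply, Module.algebraMap_end_apply]
      refine p.smul_mem _ ?_
      induction i with
      | zero => exact hx
      | succ i ih =>
        rw [pow_succ', Module.End.mul_apply]
        exact hp _ ih
  rw [hsum]
  exact hpq q _ hv

variable {A : Type*} [CommRing A] [Algebra ℂ A] (D : Derivation ℂ A A)

/-- By Leibniz, each term of the expansion differentiates `a` at least `i` times or `b` at least `j`
times. -/
theorem derivation_pow_mul_eq_zero {i j : ℕ} {a b : A}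
    (ha : ((D : Module.End ℂ A) ^ i) a = 0) (hb : ((D : Module.End ℂ A) ^ j) b = 0) :
    ((D : Module.End ℂ A) ^ (i + j)) (a * b) = 0 := by
  induction hN : i + j generalizing i j a b with
  | zero =>
    obtain ⟨rfl, rfl⟩ : i = 0 ∧ j = 0 := by omega
    have : a = 0 := ha
    simp [this]
  | succ N ih =>
    rcases i with _ | i
    · have : a = 0 := ha
      simp [this]
    rcases j with _ | j
    · have : b = 0 := hb
      simp [this]
    have h1 := ih (i := i + 1) (j := j) ha (by rwa [pow_succ, Module.End.mul_apply] at hb)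
      (by omega)
    have h2 := ih (i := i) (j := j + 1) (by rwa [pow_succ, Module.End.mul_apply] at ha) hb
      (by omega)
    rw [pow_succ, Module.End.mul_apply]
    have e : (D : Module.End ℂ A) (a * b) = a * (D : Module.End ℂ A) b
        + (D : Module.End ℂ A) a * b := by
      simp [mul_comm]
    rw [e, map_add, h1, h2, add_zero]

/-- Eigenvalues of a derivation add under multiplication of eigenvectors. Diagonalizability can thus
be tested on algebra generators. -/
theorem mul_mem_iSup_eigenspace {a b : A} (ha : a ∈ ⨆ c, Module.End.eigenspace (D : Module.End ℂ A) c)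
    (hb : b ∈ ⨆ c, Module.End.eigenspace (D : Module.End ℂ A) c) :
    a * b ∈ ⨆ c, Module.End.eigenspace (D : Module.End ℂ A) c := by
  induction ha using Submodule.iSup_induction' with
  | zero => simp
  | add x y _ _ hx hy => rw [add_mul]; exact Submodule.add_mem _ hx hy
  | mem c x hx =>
    induction hb using Submodule.iSup_induction' with
    | zero => simp
    | add y z _ _ hy hz => rw [mul_add]; exact Submodule.add_mem _ hy hz
    | mem d y hy =>
      refine Submodule.mem_iSup_of_mem (c + d) ?_
      rw [Module.End.mem_eigenspace_iff] at *
      have hx' : D x = c • x := hx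
      have hy' : D y = d • y := hy
      simp [hx', hy', mul_comm, add_smul, add_comm]

end Abstract

/-! ### Left-invariant derivations and the Lie algebra of an algebraic group -/

section General

variable {n : ℕ}

/-- The left-invariant derivation of the coordinate ring of `n × n`-matrices given by `X`. -/
noncomputable def leftInvDerivation (X : Matrix (Fin n) (Fin n) ℂ) :
    Derivation ℂ (MvPolynomial (Fin n × Fin n) ℂ) (MvPolynomial (Fin n × Fin n) ℂ) :=
  MvPolynomial.mkDerivation ℂ fun ij => ∑ k, X k ij.2 • MvPolynomial.X (ij.1, k)

theorem leftInvDerivation_X (X : Matrix (Fin n) (Fin n) ℂ) (i j : Fin n) :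
    leftInvDerivation X (MvPolynomial.X (i, j)) = ∑ k, X k j • MvPolynomial.X (i, k) :=
  MvPolynomial.mkDerivation_X _ _ _

theorem leftInvDerivation_add (X Y : Matrix (Fin n) (Fin n) ℂ) :
    leftInvDerivation (X + Y) = leftInvDerivation X + leftInvDerivation Y := by
  refine MvPolynomial.derivation_ext fun ⟨i, j⟩ => ?_
  simp [leftInvDerivation_X, add_smul, Finset.sum_add_distrib]

/-- On the span of the coordinates, composing derivations amounts to multiplying matrices.
Commutators and powers are computed from this. -/
theorem leftInvDerivation_leftInvDerivation_X (X Y : Matrix (Fin n) (Fin n) ℂ) (i j : Fin n) :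
    leftInvDerivation X (leftInvDerivation Y (MvPolynomial.X (i, j))) =
      ∑ k, (X * Y) k j • MvPolynomial.X (i, k) := by
  simp only [leftInvDerivation_X, map_sum, Derivation.map_smul, Finset.smul_sum, smul_smul,
    Matrix.mul_apply, Finset.sum_smul]
  rw [Finset.sum_comm]
  simp only [mul_comm]

theorem leftInvDerivation_commute {X Y : Matrix (Fin n) (Fin n) ℂ} (h : Commute X Y) :
    Commute (leftInvDerivation X : Module.End ℂ (MvPolynomial (Fin n × Fin n) ℂ))
      (leftInvDerivation Y : Module.End ℂ (MvPolynomial (Fin n × Fin n) ℂ)) := by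
  have e : ⁅leftInvDerivation X, leftInvDerivation Y⁆ = 0 := by
    refine MvPolynomial.derivation_ext fun ⟨i, j⟩ => ?_
    rw [Derivation.commutator_apply, leftInvDerivation_leftInvDerivation_X,
      leftInvDerivation_leftInvDerivation_X, h.eq, sub_self, Derivation.zero_apply]
  refine LinearMap.ext fun P => ?_
  have := Derivation.congr_fun e P
  rw [Derivation.commutator_apply, Derivation.zero_apply, sub_eq_zero] at this
  exact this

theorem leftInvDerivation_pow_X (X : Matrix (Fin n) (Fin n) ℂ) (i j : Fin n) (k : ℕ) :
    ((leftInvDerivation X : Module.End ℂ (MvPolynomial (Fin n × Fin n) ℂ)) ^ k)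
      (MvPolynomial.X (i, j)) = ∑ l, (X ^ k) l j • MvPolynomial.X (i, l) := by
  induction k with
  | zero => simp [Matrix.one_apply]
  | succ k ih =>
    have := leftInvDerivation_leftInvDerivation_X X (X ^ k) i j
    rw [leftInvDerivation_X] at this
    rw [pow_succ', Module.End.mul_apply, ih, pow_succ', ← this]
    rfl

/-- The `k`-th power kills every coordinate when `N ^ k = 0`, and Leibniz extends this to products,
with an exponent that depends on `P`. -/
theorem leftInvDerivation_locally_nilpotent {N : Matrix (Fin n) (Fin n) ℂ} (hN : IsNilpotent N)
    (P : MvPolynomial (Fin n × Fin n) ℂ) :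
    ∃ k : ℕ, ((leftInvDerivation N : Module.End ℂ (MvPolynomial (Fin n × Fin n) ℂ)) ^ k) P = 0 := by
  obtain ⟨k, hk⟩ := hN
  induction P using MvPolynomial.induction_on with
  | C a => exact ⟨1, by simp⟩
  | add P Q hP hQ =>
    obtain ⟨i, hi⟩ := hP
    obtain ⟨j, hj⟩ := hQ
    exact ⟨i + j, by
      rw [map_add, Module.End.pow_map_zero_of_le (Nat.le_add_right i j) hi,
        Module.End.pow_map_zero_of_le (Nat.le_add_left j i) hj, add_zero]⟩
  | mul_X P ij hP =>
    obtain ⟨i, hi⟩ := hP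
    refine ⟨i + k, derivation_pow_mul_eq_zero _ hi ?_⟩
    rw [leftInvDerivation_pow_X, hk]
    simp

theorem mem_iSup_eigenspace_leftInvDerivation {S : Matrix (Fin n) (Fin n) ℂ} {c : ℂ} (hc : c ≠ 0)
    (hS : S * S = c • S) (P : MvPolynomial (Fin n × Fin n) ℂ) :
    P ∈ ⨆ a, Module.End.eigenspace (leftInvDerivation S :
      Module.End ℂ (MvPolynomial (Fin n × Fin n) ℂ)) a := by
  induction P using MvPolynomial.induction_on with
  | C a =>
    refine Submodule.mem_iSup_of_mem 0 ?_
    simp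
  | add P Q hP hQ => exact Submodule.add_mem _ hP hQ
  | mul_X P ij hP =>
    refine mul_mem_iSup_eigenspace _ hP ?_
    obtain ⟨i, j⟩ := ij
    set D := leftInvDerivation S
    have hDD : D (D (MvPolynomial.X (i, j))) = c • D (MvPolynomial.X (i, j)) := by
      rw [leftInvDerivation_leftInvDerivation_X, hS, leftInvDerivation_X, Finset.smul_sum]
      simp [smul_smul]
    -- As `c⁻¹ • S` is a projection, each coordinate splits into eigenvectors for the eigenvalues
    -- `c` and `0`.
    have e : (MvPolynomial.X (i, j) : MvPolynomial (Fin n × Fin n) ℂ) =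
        c⁻¹ • D (MvPolynomial.X (i, j)) +
          (MvPolynomial.X (i, j) - c⁻¹ • D (MvPolynomial.X (i, j))) := by abel
    rw [e]
    refine Submodule.add_mem _ (Submodule.mem_iSup_of_mem c ?_) (Submodule.mem_iSup_of_mem 0 ?_)
    · rw [Module.End.mem_eigenspace_iff]
      simp [hDD, smul_smul, hc]
    · rw [Module.End.mem_eigenspace_iff]
      simp [hDD, smul_smul, hc]

/-- Both sides obey the Leibniz rule at the identity and take the value `X i j` on the coordinates.
-/
theorem eval_one_leftInvDerivation (P : MvPolynomial (Fin n × Fin n) ℂ)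
    (X : Matrix (Fin n) (Fin n) ℂ) :
    MvPolynomial.eval (point 1) (leftInvDerivation X P) = differentialAtOne P X := by
  induction P using MvPolynomial.induction_on with
  | C a => simp [differentialAtOne]
  | add P Q hP hQ => simp [hP, hQ, differentialAtOne, add_mul, Finset.sum_add_distrib]
  | mul_X P ij hP =>
    obtain ⟨i, j⟩ := ij
    have e : differentialAtOne (P * MvPolynomial.X (i, j)) X =
        MvPolynomial.eval (point 1) P * X i j +
          (1 : Matrix (Fin n) (Fin n) ℂ) i j * differentialAtOne P X := by
      simp only [differentialAtOne, MvPolynomial.pderiv_mul, MvPolynomial.pderiv_X, map_add,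
        map_mul, MvPolynomial.eval_X, add_mul, Finset.sum_add_distrib,
        ← Fintype.sum_prod_type', Prod.mk.eta]
      rw [add_comm, Finset.mul_sum]
      congr 1
      · simp [Pi.single_apply, apply_ite]
      · refine Finset.sum_congr rfl fun _ _ => ?_
        simp only [point]
        ring
    rw [e, Derivation.leibniz, leftInvDerivation_X, map_add, smul_eq_mul, smul_eq_mul, map_mul,
      map_mul, hP]
    simp [point, Matrix.one_apply]

/-- Left translation of polynomial functions by a matrix. -/
noncomputable def leftTranslate (g : Matrix (Fin n) (Fin n) ℂ) :
    MvPolynomial (Fin n × Fin n) ℂ →ₐ[ℂ] MvPolynomial (Fin n × Fin n) ℂ :=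
  MvPolynomial.aeval fun ij => ∑ k, g ij.1 k • MvPolynomial.X (k, ij.2)

theorem eval_leftTranslate (g x : Matrix (Fin n) (Fin n) ℂ) (P : MvPolynomial (Fin n × Fin n) ℂ) :
    MvPolynomial.eval (point x) (leftTranslate g P) = MvPolynomial.eval (point (g * x)) P := by
  induction P using MvPolynomial.induction_on with
  | C a => simp [leftTranslate]
  | add P Q hP hQ => simp [hP, hQ]
  | mul_X P ij hP =>
    rw [map_mul, map_mul, map_mul, hP]
    simp [leftTranslate, point, Matrix.mul_apply]

/-- The derivation comes from multiplication on the right, which commutes with multiplication on the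
left. -/
theorem leftInvDerivation_leftTranslate (X g : Matrix (Fin n) (Fin n) ℂ)
    (P : MvPolynomial (Fin n × Fin n) ℂ) :
    leftInvDerivation X (leftTranslate g P) = leftTranslate g (leftInvDerivation X P) := by
  induction P using MvPolynomial.induction_on with
  | C a => simp [leftTranslate]
  | add P Q hP hQ => simp [hP, hQ]
  | mul_X P ij hP =>
    have e : leftInvDerivation X (leftTranslate g (MvPolynomial.X ij)) =
        leftTranslate g (leftInvDerivation X (MvPolynomial.X ij)) := by
      obtain ⟨i, j⟩ := ij
      simp only [leftInvDerivation_X, map_sum, leftTranslate, MvPolynomial.aeval_X,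
        Derivation.map_smul, map_smul, Finset.smul_sum, smul_smul]
      rw [Finset.sum_comm]
      simp only [mul_comm]
    rw [map_mul, Derivation.leibniz, Derivation.leibniz, hP, e]
    simp

theorem mem_groupIdeal {G : Subgroup (GL (Fin n) ℂ)} {P : MvPolynomial (Fin n × Fin n) ℂ} :
    P ∈ groupIdeal G ↔
      ∀ g ∈ G, MvPolynomial.eval (point (g : Matrix (Fin n) (Fin n) ℂ)) P = 0 := by
  simp [groupIdeal, MvPolynomial.mem_vanishingIdeal_iff, MvPolynomial.aeval_eq_eval]

/-- The Lie algebra of `G` consists of the matrices whose left-invariant derivation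
preserves `I(G)`. -/
theorem differentialAtOne_eq_zero_iff {G : Subgroup (GL (Fin n) ℂ)}
    {X : Matrix (Fin n) (Fin n) ℂ} :
    (∀ P ∈ groupIdeal G, differentialAtOne P X = 0) ↔
      ∀ P ∈ groupIdeal G, leftInvDerivation X P ∈ groupIdeal G := by
  refine ⟨fun hX P hP => mem_groupIdeal.2 fun g hg => ?_, fun hX P hP => ?_⟩
  -- Translation by `g` stays inside `I(G)` and moves the evaluation at `g` to the identity, where
  -- the hypothesis applies.
  · have hgP : leftTranslate (g : Matrix (Fin n) (Fin n) ℂ) P ∈ groupIdeal G := by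
      refine mem_groupIdeal.2 fun x hx => ?_
      rw [eval_leftTranslate, ← Units.val_mul]
      exact mem_groupIdeal.1 hP _ (G.mul_mem hg hx)
    have := hX _ hgP
    rwa [← eval_one_leftInvDerivation, leftInvDerivation_leftTranslate, eval_leftTranslate,
      mul_one] at this
  · rw [← eval_one_leftInvDerivation]
    exact mem_groupIdeal.1 (hX P hP) 1 G.one_mem

/-- An algebraic Lie algebra contains the semisimple part `S` of each of its elements `S + N`,
here for `S` proportional to a projection. -/
theorem IsAlgebraic.semisimple_part_mem {L : LieSubalgebra ℂ (Matrix (Fin n) (Fin n) ℂ)}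
    (hL : IsAlgebraic L) {S N : Matrix (Fin n) (Fin n) ℂ} {c : ℂ} (hc : c ≠ 0)
    (hS : S * S = c • S) (hN : IsNilpotent N) (hSN : Commute S N) (hX : S + N ∈ L) : S ∈ L := by
  obtain ⟨G, -, hG⟩ := hL
  rw [hG, differentialAtOne_eq_zero_iff] at hX ⊢
  intro P hP
  refine apply_semisimple_mem (p := (groupIdeal G).restrictScalars ℂ)
    (leftInvDerivation_commute hSN) (leftInvDerivation_locally_nilpotent hN) (fun Q hQ => ?_) hP
    (mem_iSup_eigenspace_leftInvDerivation hc hS P)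
  have := hX Q hQ
  rwa [leftInvDerivation_add] at this

/-! ### Multiplicatively closed spaces of matrices are algebraic -/

/-- The group of invertible matrices in `1 + A`, for a multiplicatively closed subspace `A`. -/
def oneAddGroup (A : Submodule ℂ (Matrix (Fin n) (Fin n) ℂ))
    (hA : ∀ x ∈ A, ∀ y ∈ A, x * y ∈ A) : Subgroup (GL (Fin n) ℂ) where
  carrier := {g | (g : Matrix (Fin n) (Fin n) ℂ) - 1 ∈ A}
  one_mem' := by simp
  mul_mem' := by
    intro a b ha hb
    have e : ((a * b : GL (Fin n) ℂ) : Matrix (Fin n) (Fin n) ℂ) - 1 =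
        ((a : Matrix (Fin n) (Fin n) ℂ) - 1) * ((b : Matrix (Fin n) (Fin n) ℂ) - 1) +
          ((a : Matrix (Fin n) (Fin n) ℂ) - 1) + ((b : Matrix (Fin n) (Fin n) ℂ) - 1) := by
      rw [Units.val_mul]
      noncomm_ring
    rw [Set.mem_ofPred_eq, e]
    exact A.add_mem (A.add_mem (hA _ ha _ hb) ha) hb
  inv_mem' := by
    intro g hg
    -- Left multiplication by `g` is injective on the finite-dimensional `A`, hence onto. Solving `g
    -- * y = -(g - 1)` in `A` gives the inverse `1 + y`.
    have hmap : ∀ y ∈ A, LinearMap.mulLeft ℂ (g : Matrix (Fin n) (Fin n) ℂ) y ∈ A := by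
      intro y hy
      have e : (g : Matrix (Fin n) (Fin n) ℂ) * y =
          ((g : Matrix (Fin n) (Fin n) ℂ) - 1) * y + y := by noncomm_ring
      rw [LinearMap.mulLeft_apply, e]
      exact A.add_mem (hA _ hg _ hy) hy
    have hinj : Function.Injective
        ((LinearMap.mulLeft ℂ (g : Matrix (Fin n) (Fin n) ℂ)).restrict hmap) := by
      intro y z hyz
      exact Subtype.ext (g.isUnit.mul_left_cancel (congrArg Subtype.val hyz))
    obtain ⟨y, hy⟩ := LinearMap.surjective_of_injective hinj ⟨_, A.neg_mem hg⟩
    have hy' : (g : Matrix (Fin n) (Fin n) ℂ) * y = -((g : Matrix (Fin n) (Fin n) ℂ) - 1) :=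
      congrArg Subtype.val hy
    have e : ((g⁻¹ : GL (Fin n) ℂ) : Matrix (Fin n) (Fin n) ℂ) = 1 + y := by
      rw [Units.inv_eq_of_mul_eq_one_right]
      rw [mul_add, hy']
      noncomm_ring
    rw [Set.mem_ofPred_eq, e, add_sub_cancel_left]
    exact y.2

/-- The affine polynomial `g ↦ f (g - 1)` given by a linear form `f` on matrices. -/
noncomputable def affinePolynomial (f : Module.Dual ℂ (Matrix (Fin n) (Fin n) ℂ)) :
    MvPolynomial (Fin n × Fin n) ℂ :=
  ∑ i, ∑ j, f (Matrix.single i j 1) •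
    (MvPolynomial.X (i, j) - MvPolynomial.C ((1 : Matrix (Fin n) (Fin n) ℂ) i j))

theorem dual_apply_eq_sum (f : Module.Dual ℂ (Matrix (Fin n) (Fin n) ℂ))
    (X : Matrix (Fin n) (Fin n) ℂ) : f X = ∑ i, ∑ j, f (Matrix.single i j 1) * X i j := by
  conv_lhs => rw [Matrix.matrix_eq_sum_single X]
  simp only [map_sum]
  refine Finset.sum_congr rfl fun i _ => Finset.sum_congr rfl fun j _ => ?_
  rw [mul_comm, ← smul_eq_mul, ← map_smul, Matrix.smul_single, smul_eq_mul, mul_one]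

theorem eval_affinePolynomial (f : Module.Dual ℂ (Matrix (Fin n) (Fin n) ℂ))
    (X : Matrix (Fin n) (Fin n) ℂ) :
    MvPolynomial.eval (point X) (affinePolynomial f) = f (X - 1) := by
  rw [dual_apply_eq_sum f (X - 1)]
  simp [affinePolynomial, point, MvPolynomial.smul_eval]

theorem differentialAtOne_affinePolynomial (f : Module.Dual ℂ (Matrix (Fin n) (Fin n) ℂ))
    (X : Matrix (Fin n) (Fin n) ℂ) : differentialAtOne (affinePolynomial f) X = f X := by
  rw [dual_apply_eq_sum f X, ← eval_one_leftInvDerivation, affinePolynomial]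
  simp only [map_sum, Derivation.map_smul, map_sub, MvPolynomial.derivation_C, sub_zero,
    leftInvDerivation_X, MvPolynomial.smul_eval, MvPolynomial.eval_X, point]
  simp [Matrix.one_apply]

/-- A polynomial vanishing at all invertible matrices `1 + tX` has `dP(X) = 0`. -/
theorem differentialAtOne_eq_zero_of_line {P : MvPolynomial (Fin n × Fin n) ℂ}
    {X : Matrix (Fin n) (Fin n) ℂ}
    (hP : ∀ t : ℂ, IsUnit (1 + t • X).det → MvPolynomial.eval (point (1 + t • X)) P = 0) :
    differentialAtOne P X = 0 := by
  let M : Matrix (Fin n) (Fin n) (Polynomial ℂ) :=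
    Matrix.of fun i j => Polynomial.C ((1 : Matrix (Fin n) (Fin n) ℂ) i j) +
      Polynomial.X * Polynomial.C (X i j)
  let φ : MvPolynomial (Fin n × Fin n) ℂ →ₐ[ℂ] Polynomial ℂ :=
    MvPolynomial.aeval fun ij => M ij.1 ij.2
  have hφX : ∀ i j, φ (MvPolynomial.X (i, j)) =
      Polynomial.C ((1 : Matrix (Fin n) (Fin n) ℂ) i j) + Polynomial.X * Polynomial.C (X i j) :=
    fun i j => MvPolynomial.aeval_X _ _
  have hφ : ∀ (Q : MvPolynomial (Fin n × Fin n) ℂ) (t : ℂ),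
      (φ Q).eval t = MvPolynomial.eval (point (1 + t • X)) Q := by
    intro Q t
    induction Q using MvPolynomial.induction_on with
    | C a => simp [φ]
    | add Q R hQ hR => simp [hQ, hR]
    | mul_X Q ij hQ =>
      simp only [map_mul, Polynomial.eval_mul, hQ, MvPolynomial.eval_X]
      simp [hφX, point, mul_comm t]
  have hM : ∀ t : ℂ, M.det.eval t = (1 + t • X).det := by
    intro t
    rw [← Polynomial.coe_evalRingHom, RingHom.map_det]
    congr 1
    ext i j
    simp only [M, RingHom.mapMatrix_apply, Matrix.map_apply, Matrix.of_apply,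
      Polynomial.coe_evalRingHom, Polynomial.eval_add, Polynomial.eval_mul, Polynomial.eval_C,
      Polynomial.eval_X, Matrix.add_apply, Matrix.smul_apply, smul_eq_mul]
  -- Chain rule: the derivative at `t = 0` along `1 + t X` is the differential at the identity.
  have hder : ∀ Q : MvPolynomial (Fin n × Fin n) ℂ,
      (Polynomial.derivative (φ Q)).eval 0 =
        MvPolynomial.eval (point 1) (leftInvDerivation X Q) := by
    intro Q
    induction Q using MvPolynomial.induction_on with
    | C a => simp [φ]
    | add Q R hQ hR => simp [hQ, hR]
    | mul_X Q ij hQ =>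
      have h0 := hφ Q 0
      rw [zero_smul, add_zero] at h0
      rw [map_mul, Polynomial.derivative_mul, Derivation.leibniz, leftInvDerivation_X]
      simp only [hφX, map_sum, map_mul, MvPolynomial.smul_eval, MvPolynomial.eval_X, point,
        Polynomial.derivative_mul, Polynomial.derivative_C,
        Polynomial.derivative_X, Polynomial.eval_add, Polynomial.eval_mul, Polynomial.eval_C,
        Polynomial.eval_X, hQ, map_add, smul_eq_mul]
      simp [Matrix.one_apply] at h0 ⊢
      simp [h0]
      ring
  have hzero : φ P = 0 := by
    -- The hypothesis covers only invertible `1 + t X`. The determinant handles the remaining `t`,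
    -- and it can be cancelled because its value at `0` is `1`.
    have hprod : φ P * M.det = 0 := by
      refine Polynomial.funext fun t => ?_
      rw [Polynomial.eval_mul, hφ, hM, Polynomial.eval_zero]
      by_cases ht : (1 + t • X).det = 0
      · rw [ht, mul_zero]
      · rw [hP t (isUnit_iff_ne_zero.2 ht), zero_mul]
    refine (mul_eq_zero.1 hprod).resolve_right fun h => ?_
    have := hM 0
    simp [h] at this
  rw [← eval_one_leftInvDerivation, ← hder, hzero]
  simp

/-- A multiplicatively closed space of matrices is an algebraic Lie algebra. -/
theorem isAlgebraic_of_mul_mem (L : LieSubalgebra ℂ (Matrix (Fin n) (Fin n) ℂ))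
    (hL : ∀ x ∈ L, ∀ y ∈ L, x * y ∈ L) : IsAlgebraic L := by
  -- The linear forms that vanish on `L` define `L`; shifted by `1`, they define the group.
  have hmem : ∀ X, X ∈ L ↔ ∀ f ∈ L.toSubmodule.dualAnnihilator, f X = 0 := fun X =>
    (Subspace.forall_mem_dualAnnihilator_apply_eq_zero_iff L.toSubmodule X).symm
  refine ⟨oneAddGroup L.toSubmodule hL,
    ⟨affinePolynomial '' (L.toSubmodule.dualAnnihilator : Set _), fun g => ?_⟩, fun X => ?_⟩
  · rw [Set.forall_mem_image]
    simp only [eval_affinePolynomial]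
    exact hmem _
  · refine ⟨fun hX P hP => differentialAtOne_eq_zero_of_line fun t ht => ?_, fun hX => ?_⟩
    · refine mem_groupIdeal.1 hP (Matrix.nonsingInvUnit _ ht) ?_
      change (1 + t • X) - 1 ∈ L.toSubmodule
      rw [add_sub_cancel_left]
      exact L.smul_mem t hX
    · refine (hmem X).2 fun f hf => ?_
      rw [← differentialAtOne_affinePolynomial]
      refine hX _ (mem_groupIdeal.2 fun g hg => ?_)
      rw [eval_affinePolynomial]
      exact (hmem _).1 hg f hf

end General

/-! ### Semisimple matrices and comparison of Jordan decompositions -/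

theorem IsSemisimple.add_of_commute {n : ℕ} {S T : Matrix (Fin n) (Fin n) ℂ}
    (hS : IsSemisimple S) (hT : IsSemisimple T) (h : Commute S T) : IsSemisimple (S + T) := by
  have h' : Commute (Matrix.toLin' S) (Matrix.toLin' T) := h.map (Matrix.toLinAlgEquiv' (R := ℂ))
  unfold IsSemisimple
  rw [map_add]
  exact Module.End.IsSemisimple.add_of_commute h' hS hT

theorem IsSemisimple.smul {n : ℕ} {S : Matrix (Fin n) (Fin n) ℂ} (hS : IsSemisimple S) (c : ℂ) :
    IsSemisimple (c • S) := by
  unfold IsSemisimple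
  rw [map_smul]
  exact Module.End.IsSemisimple_smul c hS

theorem IsSemisimple.sub_of_commute {n : ℕ} {S T : Matrix (Fin n) (Fin n) ℂ}
    (hS : IsSemisimple S) (hT : IsSemisimple T) (h : Commute S T) : IsSemisimple (S - T) := by
  have := hS.add_of_commute (hT.smul (-1)) (h.smul_right (-1))
  rwa [neg_one_smul, ← sub_eq_add_neg] at this

theorem IsSemisimple.eq_zero_of_isNilpotent {n : ℕ} {S : Matrix (Fin n) (Fin n) ℂ}
    (hS : IsSemisimple S) (hN : IsNilpotent S) : S = 0 := by
  have := Module.End.eq_zero_of_isNilpotent_isSemisimple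
    (hN.map (Matrix.toLinAlgEquiv' (R := ℂ))) hS
  exact (Matrix.toLin' (R := ℂ)).map_eq_zero_iff.1 this

/-- `S` is a root of `X (X - c)`, which is squarefree as `c ≠ 0`. -/
theorem isSemisimple_of_mul_self {n : ℕ} {S : Matrix (Fin n) (Fin n) ℂ} {c : ℂ} (hc : c ≠ 0)
    (hS : S * S = c • S) : IsSemisimple S := by
  refine Module.End.isSemisimple_of_squarefree_aeval_eq_zero
    (p := Polynomial.X * (Polynomial.X - Polynomial.C c)) ?_ ?_
  · refine squarefree_mul_iff.2 ⟨?_, Polynomial.irreducible_X.squarefree,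
      (Polynomial.irreducible_X_sub_C c).squarefree⟩
    refine IsCoprime.isRelPrime ?_
    have := Polynomial.isCoprime_X_sub_C_of_isUnit_sub (a := (0 : ℂ)) (b := c)
      (by simpa using hc)
    simpa using this
  · have : Matrix.toLin' S * Matrix.toLin' S = c • Matrix.toLin' S := by
      rw [← map_smul, ← hS, Matrix.toLin'_mul]; rfl
    simp [mul_sub, this, Algebra.algebraMap_eq_smul_one]

/-- Two Jordan decompositions agree if all parts of one commute with all parts of the other. -/
theorem IsJordanDecomposition.eq_of_commute {n : ℕ} {X S N T M : Matrix (Fin n) (Fin n) ℂ}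
    (h : IsJordanDecomposition X S N) (h' : IsJordanDecomposition X T M) (hST : Commute S T)
    (hNM : Commute N M) : S = T ∧ N = M := by
  obtain ⟨e, hS, hN, -⟩ := h
  obtain ⟨e', hT, hM, -⟩ := h'
  -- This difference is both semisimple and nilpotent, hence zero.
  have e₁ : S - T = M - N := by
    rw [sub_eq_sub_iff_add_eq_add, ← e, add_comm, ← e']
  have e₂ : S - T = 0 := (hS.sub_of_commute hT hST).eq_zero_of_isNilpotent
    (e₁ ▸ hNM.symm.isNilpotent_sub hM hN)
  exact ⟨sub_eq_zero.1 e₂, (sub_eq_zero.1 (e₁ ▸ e₂)).symm⟩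

/-! ### Multiplication table and structure of `m` -/

/-- The nilpotent elements of `m`. -/
noncomputable def nilMat (a b c : ℂ) : Matrix (Fin 4) (Fin 4) ℂ :=
  !![0, 0, 0, a;
     0, 0, 0, -a;
     b, -b, 0, c;
     0, 0, 0, 0]

/-- Products of two land in the single entry `(2, 3)`, so products of three vanish. -/
theorem nilMat_mul (a b c a' b' c' : ℂ) :
    nilMat a b c * nilMat a' b' c' = nilMat 0 0 (2 * b * a') := by
  ext i j
  fin_cases i <;> fin_cases j <;>
    simp [nilMat, Matrix.mul_apply, Fin.sum_univ_four]
  ring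

theorem nilMat_mul_X₄ (α β a b c : ℂ) : nilMat a b c * X₄ α β = 0 := by
  ext i j
  fin_cases i <;> fin_cases j <;> simp [nilMat, X₄, Matrix.mul_apply, Fin.sum_univ_four]

theorem X₄_mul_nilMat (α β a b c : ℂ) : X₄ α β * nilMat a b c = 0 := by
  ext i j
  fin_cases i <;> fin_cases j <;> simp [nilMat, X₄, Matrix.mul_apply, Fin.sum_univ_four]

theorem X₄_mul_X₄ (α β : ℂ) : X₄ α β * X₄ α β = (2 : ℂ) • X₄ α β := by
  ext i j
  fin_cases i <;> fin_cases j <;> simp [X₄, Matrix.mul_apply, Fin.sum_univ_four] <;> ring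

theorem X₄_commute_nilMat (α β a b c : ℂ) : Commute (X₄ α β) (nilMat a b c) := by
  rw [Commute, SemiconjBy, nilMat_mul_X₄, X₄_mul_nilMat]

theorem nilMat_isNilpotent (a b c : ℂ) : IsNilpotent (nilMat a b c) := by
  refine ⟨3, ?_⟩
  rw [pow_three, nilMat_mul, nilMat_mul]
  ext i j
  fin_cases i <;> fin_cases j <;> simp [nilMat]

theorem X₄_isSemisimple (α β : ℂ) : IsSemisimple (X₄ α β) :=
  isSemisimple_of_mul_self two_ne_zero (X₄_mul_X₄ α β)

theorem nilMat_eq_zero {a b c : ℂ} (h : nilMat a b c = 0) : a = 0 ∧ b = 0 ∧ c = 0 :=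
  ⟨by simpa [nilMat] using congrFun (congrFun h 0) 3,
    by simpa [nilMat] using congrFun (congrFun h 2) 0,
    by simpa [nilMat] using congrFun (congrFun h 2) 3⟩

/-- The trace detects `s`: it is `2` on `X₄` and `0` on `nilMat`. -/
theorem smul_X₄_add_nilMat_isNilpotent {α β s a b c : ℂ}
    (h : IsNilpotent (s • X₄ α β + nilMat a b c)) : s = 0 := by
  have := (Matrix.isNilpotent_trace_of_isNilpotent h).eq_zero
  have e : (s • X₄ α β + nilMat a b c).trace = s + s := by
    simp [Matrix.trace, Fin.sum_univ_four, X₄, nilMat]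
  rw [e, ← two_mul] at this
  simpa using this

/-- Subtracting the commuting semisimple `s • X₄ α β` leaves a matrix that is semisimple and
nilpotent. -/
theorem smul_X₄_add_nilMat_isSemisimple {α β s a b c : ℂ}
    (h : IsSemisimple (s • X₄ α β + nilMat a b c)) : nilMat a b c = 0 := by
  refine IsSemisimple.eq_zero_of_isNilpotent ?_ (nilMat_isNilpotent a b c)
  have := h.sub_of_commute ((X₄_isSemisimple α β).smul s)
    (((Commute.refl _).add_left
      (((X₄_commute_nilMat α β a b c).smul_left s).symm)))
  rwa [add_sub_cancel_left] at this

theorem hMat_eq (α β x₁ x₂ x₃ : ℂ) :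
    hMat α β x₁ x₂ x₃ = (x₁ + x₂) • X₄ α β + nilMat ((x₁ - x₂) / 2)
      ((α - β) * ((x₁ - x₂) / 2) - x₂) (x₃ - (x₁ + x₂) * (α + β) / 4) := by
  ext i j
  fin_cases i <;> fin_cases j <;> simp [hMat, X₄, nilMat] <;> ring

/-- The parameters invert those of `hMat_eq`: `x₂ = (α - β) a - b` and `x₁ = x₂ + 2 a`, with `x₃`
read off from the entry `(2, 3)`. Every `nilMat` is thus the nilpotent part of an element of `h`. -/
theorem nilMat_eq (α β a b c : ℂ) :
    nilMat a b c = hMat α β ((α - β) * a - b + 2 * a) ((α - β) * a - b)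
      (c + ((α - β) * a - b + a) * (α + β) / 2)
      - (2 * ((α - β) * a - b + a)) • X₄ α β := by
  rw [hMat_eq]
  ext i j
  fin_cases i <;> fin_cases j <;> simp [X₄, nilMat] <;> ring

theorem mem_m_iff {α β : ℂ} {X : Matrix (Fin 4) (Fin 4) ℂ} :
    X ∈ m α β ↔ ∃ s a b c : ℂ, X = s • X₄ α β + nilMat a b c := by
  change X ∈ (h α β).toSubmodule ⊔ Submodule.span ℂ {X₄ α β} ↔ _
  constructor
  · intro hX
    obtain ⟨_, ⟨x₁, x₂, x₃, rfl⟩, _, hS, rfl⟩ := Submodule.mem_sup.1 hX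
    obtain ⟨c, rfl⟩ := Submodule.mem_span_singleton.1 hS
    rw [hMat_eq]
    exact ⟨x₁ + x₂ + c, _, _, _, by rw [add_smul _ c]; exact add_right_comm _ _ _⟩
  · rintro ⟨s, a, b, c, rfl⟩
    rw [nilMat_eq α β]
    rw [add_sub_left_comm, ← sub_smul]
    exact Submodule.add_mem_sup ⟨_, _, _, rfl⟩ (Submodule.mem_span_singleton.2 ⟨_, rfl⟩)

theorem m_mul_mem (α β : ℂ) : ∀ x ∈ m α β, ∀ y ∈ m α β, x * y ∈ m α β := by
  intro x hx y hy
  obtain ⟨s, a, b, c, rfl⟩ := mem_m_iff.1 hx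
  obtain ⟨s', a', b', c', rfl⟩ := mem_m_iff.1 hy
  -- The mixed products vanish, leaving `s s' X₄² = 2 s s' X₄` and the product of the nilpotent
  -- parts.
  refine mem_m_iff.2 ⟨2 * s * s', 0, 0, 2 * b * a', ?_⟩
  simp only [add_mul, mul_add, smul_mul_assoc, mul_smul_comm, X₄_mul_X₄, X₄_mul_nilMat,
    nilMat_mul_X₄, nilMat_mul, smul_zero, smul_smul, add_zero, zero_add]
  congr 2
  ring

/-- `nilMat` as a linear map. -/
noncomputable def nilMatLinear : (Fin 3 → ℂ) →ₗ[ℂ] Matrix (Fin 4) (Fin 4) ℂ where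
  toFun v := nilMat (v 0) (v 1) (v 2)
  map_add' v w := by
    ext i j
    fin_cases i <;> fin_cases j <;> simp [nilMat] <;> ring
  map_smul' c v := by
    ext i j
    fin_cases i <;> fin_cases j <;> simp [nilMat]

theorem nilMatLinear_injective : Function.Injective nilMatLinear := by
  refine (injective_iff_map_eq_zero _).2 fun v hv => ?_
  obtain ⟨h0, h1, h2⟩ := nilMat_eq_zero hv
  ext i
  fin_cases i <;> assumption

/-- The ideal of nilpotent elements of `m`. -/
noncomputable def nilIdeal : LieSubalgebra ℂ (Matrix (Fin 4) (Fin 4) ℂ) :=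
  { LinearMap.range nilMatLinear with
    lie_mem' := by
      rintro _ _ ⟨v, rfl⟩ ⟨w, rfl⟩
      rw [Ring.lie_def]
      refine (LinearMap.range nilMatLinear).sub_mem ⟨![0, 0, 2 * v 1 * w 0], ?_⟩
        ⟨![0, 0, 2 * w 1 * v 0], ?_⟩
      · exact (nilMat_mul _ _ _ _ _ _).symm
      · exact (nilMat_mul _ _ _ _ _ _).symm }

theorem mem_nilIdeal {X : Matrix (Fin 4) (Fin 4) ℂ} :
    X ∈ nilIdeal ↔ ∃ a b c : ℂ, X = nilMat a b c :=
  ⟨fun ⟨v, hv⟩ => ⟨v 0, v 1, v 2, hv.symm⟩, fun ⟨a, b, c, hX⟩ => ⟨![a, b, c], hX.symm⟩⟩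

theorem finrank_nilIdeal : Module.finrank ℂ nilIdeal = 3 :=
  (LinearMap.finrank_range_of_inj nilMatLinear_injective).trans (by simp)

/-- The line spanned by `X₄`. -/
noncomputable def X₄Line (α β : ℂ) : LieSubalgebra ℂ (Matrix (Fin 4) (Fin 4) ℂ) :=
  { Submodule.span ℂ {X₄ α β} with
    lie_mem' := by
      intro X Y hX hY
      obtain ⟨c, rfl⟩ := Submodule.mem_span_singleton.1 hX
      obtain ⟨d, rfl⟩ := Submodule.mem_span_singleton.1 hY
      simp }

theorem mem_X₄Line {α β : ℂ} {X : Matrix (Fin 4) (Fin 4) ℂ} :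
    X ∈ X₄Line α β ↔ ∃ s : ℂ, s • X₄ α β = X :=
  Submodule.mem_span_singleton

theorem X₄_ne_zero (α β : ℂ) : X₄ α β ≠ 0 := fun h => by
  simpa [X₄] using congrFun (congrFun h 0) 0

theorem mem_nilIdeal_iff {α β : ℂ} {X : Matrix (Fin 4) (Fin 4) ℂ} :
    X ∈ nilIdeal ↔ X ∈ m α β ∧ IsNilpotent X := by
  rw [mem_nilIdeal, mem_m_iff]
  constructor
  · rintro ⟨a, b, c, rfl⟩
    exact ⟨⟨0, a, b, c, by simp⟩, nilMat_isNilpotent a b c⟩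
  · rintro ⟨⟨s, a, b, c, rfl⟩, hX⟩
    exact ⟨a, b, c, by simp [smul_X₄_add_nilMat_isNilpotent hX]⟩

theorem mem_X₄Line_iff {α β : ℂ} {X : Matrix (Fin 4) (Fin 4) ℂ} :
    X ∈ X₄Line α β ↔ X ∈ m α β ∧ IsSemisimple X := by
  rw [mem_X₄Line, mem_m_iff]
  constructor
  · rintro ⟨s, rfl⟩
    refine ⟨⟨s, 0, 0, 0, ?_⟩, (X₄_isSemisimple α β).smul s⟩
    have : nilMat 0 0 0 = 0 := map_zero nilMatLinear
    rw [this, add_zero]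
  · rintro ⟨⟨s, a, b, c, rfl⟩, hX⟩
    exact ⟨s, by rw [smul_X₄_add_nilMat_isSemisimple hX, add_zero]⟩

theorem disjoint_nilIdeal_X₄Line (α β : ℂ) :
    Disjoint nilIdeal.toSubmodule (X₄Line α β).toSubmodule :=
  Submodule.disjoint_def.2 fun _ hX hX' =>
    (mem_X₄Line_iff.1 hX').2.eq_zero_of_isNilpotent ((mem_nilIdeal_iff (α := α) (β := β)).1 hX).2

theorem nilIdeal_sup_X₄Line (α β : ℂ) :
    nilIdeal.toSubmodule ⊔ (X₄Line α β).toSubmodule = (m α β).toSubmodule := by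
  refine le_antisymm (sup_le (fun X hX => (mem_nilIdeal_iff.1 hX).1)
    fun X hX => (mem_X₄Line_iff.1 hX).1) fun X hX => ?_
  obtain ⟨s, a, b, c, rfl⟩ := mem_m_iff.1 hX
  exact Submodule.mem_sup.2 ⟨_, mem_nilIdeal.2 ⟨a, b, c, rfl⟩, _, mem_X₄Line.2 ⟨s, rfl⟩,
    add_comm _ _⟩

theorem finrank_m (α β : ℂ) : Module.finrank ℂ (m α β) = 4 := by
  have h1 := Submodule.finrank_sup_add_finrank_inf_eq nilIdeal.toSubmodule
    (X₄Line α β).toSubmodule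
  rw [(disjoint_nilIdeal_X₄Line α β).eq_bot, nilIdeal_sup_X₄Line, finrank_bot, add_zero] at h1
  have h2 : Module.finrank ℂ (X₄Line α β).toSubmodule = 1 := finrank_span_singleton (X₄_ne_zero α β)
  have h3 : Module.finrank ℂ nilIdeal.toSubmodule = 3 := finrank_nilIdeal
  rw [h2, h3] at h1
  exact h1

theorem disjoint_h_span_X₄ (α β : ℂ) :
    Disjoint (h α β).toSubmodule (Submodule.span ℂ {X₄ α β}) := by
  refine Submodule.disjoint_def.2 fun X hX hX' => ?_
  obtain ⟨x₁, x₂, x₃, rfl⟩ := hX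
  have hs := (mem_X₄Line_iff.1 hX').2
  rw [hMat_eq] at hs ⊢
  -- An element of `h` in `ℂ X₄` is semisimple, so its nilpotent part is zero. This forces `x₁ =
  -- x₂`, and then `x₂ = 0`.
  have hn := smul_X₄_add_nilMat_isSemisimple hs
  obtain ⟨h1, h2, -⟩ := nilMat_eq_zero hn
  have e2 : x₂ = 0 := by rw [h1] at h2; simpa using h2
  have e1 : x₁ = 0 := by rw [e2] at h1; simpa using h1
  rw [hn, e1, e2]
  simp

/-! ### Jordan decomposition in `h` and minimality of `m` -/

theorem isJordanDecomposition_hMat (α β x₁ x₂ x₃ : ℂ) :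
    IsJordanDecomposition (hMat α β x₁ x₂ x₃) ((x₁ + x₂) • X₄ α β)
      (hMat α β x₁ x₂ x₃ - (x₁ + x₂) • X₄ α β) := by
  refine ⟨by abel, (X₄_isSemisimple α β).smul _, ?_, ?_⟩
  · rw [hMat_eq, add_sub_cancel_left]
    exact nilMat_isNilpotent _ _ _
  · rw [hMat_eq, add_sub_cancel_left]
    exact (X₄_commute_nilMat _ _ _ _ _).smul_left _

/-- The semisimple part of `s X₄ + N` is a polynomial in `s X₄ + N`. -/
theorem commute_smul_X₄ {α β s a b c : ℂ} {Y : Matrix (Fin 4) (Fin 4) ℂ}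
    (hY : Commute Y (s • X₄ α β + nilMat a b c)) : Commute Y (s • X₄ α β) := by
  by_cases hs : s = 0
  · simp [hs]
  -- Cubing kills the nilpotent part and all mixed terms, and `X₄³ = 4 X₄`; for `s ≠ 0` the
  -- semisimple part is a multiple of the cube.
  have e : (s • X₄ α β + nilMat a b c) ^ 3 = (4 * s ^ 2) • s • X₄ α β := by
    have h0 : nilMat 0 0 0 = 0 := map_zero nilMatLinear
    rw [pow_three]
    simp only [add_mul, mul_add, smul_mul_assoc, mul_smul_comm, X₄_mul_X₄, X₄_mul_nilMat,
      nilMat_mul_X₄, nilMat_mul, smul_zero, smul_smul, add_zero, zero_add, mul_zero, h0]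
    congr 1
    ring
  have h1 := (hY.pow_right 3).smul_right (4 * s ^ 2)⁻¹
  rwa [e, inv_smul_smul₀ (mul_ne_zero (by norm_num) (pow_ne_zero 2 hs))] at h1

/-- For uniqueness, the parts of any other decomposition commute with the matrix, hence with `(x₁ +
x₂) • X₄ α β`, so the two decompositions can be compared. -/
theorem isJordanDecomposition_hMat_iff (α β x₁ x₂ x₃ : ℂ) (S N : Matrix (Fin 4) (Fin 4) ℂ) :
    IsJordanDecomposition (hMat α β x₁ x₂ x₃) S N ↔
      S = (x₁ + x₂) • X₄ α β ∧ N = hMat α β x₁ x₂ x₃ - (x₁ + x₂) • X₄ α β := by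
  constructor
  · intro hX
    obtain ⟨e, -, -, hSN⟩ := id hX
    have hS : Commute S (hMat α β x₁ x₂ x₃) := by
      rw [e]; exact (Commute.refl S).add_right hSN
    have hN : Commute N (hMat α β x₁ x₂ x₃) := by
      rw [e]; exact hSN.symm.add_right (Commute.refl N)
    have key : ∀ {Y}, Commute Y (hMat α β x₁ x₂ x₃) → Commute Y ((x₁ + x₂) • X₄ α β) := by
      intro Y hY
      rw [hMat_eq] at hY
      exact commute_smul_X₄ hY
    exact hX.eq_of_commute (isJordanDecomposition_hMat α β x₁ x₂ x₃) (key hS)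
      (hN.sub_right (key hN))
  · rintro ⟨rfl, rfl⟩
    exact isJordanDecomposition_hMat α β x₁ x₂ x₃

theorem m_le_of_isAlgebraic {α β : ℂ} {L : LieSubalgebra ℂ (Matrix (Fin 4) (Fin 4) ℂ)}
    (hL : IsAlgebraic L) (hhL : h α β ≤ L) : m α β ≤ L := by
  have hX : X₄ α β ∈ L := by
    -- With `x₁ + x₂ = 1` the semisimple part is exactly `X₄`.
    have h1 : hMat α β 1 0 0 ∈ L := hhL ⟨1, 0, 0, rfl⟩
    rw [hMat_eq, add_zero, one_smul] at h1
    exact hL.semisimple_part_mem two_ne_zero (X₄_mul_X₄ α β) (nilMat_isNilpotent _ _ _)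
      (X₄_commute_nilMat _ _ _ _ _) h1
  have hle : (h α β).toSubmodule ⊔ Submodule.span ℂ {X₄ α β} ≤ L.toSubmodule :=
    sup_le hhL ((Submodule.span_singleton_le_iff_mem _ _).2 hX)
  exact hle

theorem lie_X₄Line {α β : ℂ} {X Y : Matrix (Fin 4) (Fin 4) ℂ} (hX : X ∈ m α β)
    (hY : Y ∈ X₄Line α β) : ⁅X, Y⁆ = 0 := by
  obtain ⟨s, a, b, c, rfl⟩ := mem_m_iff.1 hX
  obtain ⟨t, rfl⟩ := mem_X₄Line.1 hY
  have hc : Commute (s • X₄ α β + nilMat a b c) (t • X₄ α β) :=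
    (((Commute.refl _).smul_left s).add_left (X₄_commute_nilMat α β a b c).symm).smul_right t
  rw [Ring.lie_def, hc.eq, sub_self]

theorem lie_mem_nilIdeal {α β : ℂ} {X Y : Matrix (Fin 4) (Fin 4) ℂ} (hX : X ∈ m α β)
    (hY : Y ∈ nilIdeal) : ⁅X, Y⁆ ∈ nilIdeal := by
  obtain ⟨s, a, b, c, rfl⟩ := mem_m_iff.1 hX
  obtain ⟨a', b', c', rfl⟩ := mem_nilIdeal.1 hY
  have e : ⁅s • X₄ α β + nilMat a b c, nilMat a' b' c'⁆ = ⁅nilMat a b c, nilMat a' b' c'⁆ := by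
    simp only [Ring.lie_def, add_mul, mul_add, smul_mul_assoc, mul_smul_comm, X₄_mul_nilMat,
      nilMat_mul_X₄, smul_zero, zero_add]
  rw [e]
  exact nilIdeal.lie_mem (mem_nilIdeal.2 ⟨a, b, c, rfl⟩) hY

end AlgebraicLie

theorem mainTheorem3 (α β : ℂ) (hαβ : α + β ≠ 0) :
    -- the semisimple part of every element of `h` is a multiple of `X₄`
    (∀ (x₁ x₂ x₃ : ℂ) (S N : Matrix (Fin 4) (Fin 4) ℂ),
      AlgebraicLie.IsJordanDecomposition (AlgebraicLie.hMat α β x₁ x₂ x₃) S N ↔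
        S = (x₁ + x₂) • AlgebraicLie.X₄ α β ∧
        N = AlgebraicLie.hMat α β x₁ x₂ x₃ - (x₁ + x₂) • AlgebraicLie.X₄ α β) ∧
    -- `m = h ⊕ ℂ X₄` has dimension 4
    Disjoint (AlgebraicLie.h α β).toSubmodule (Submodule.span ℂ {AlgebraicLie.X₄ α β}) ∧
    (AlgebraicLie.h α β).toSubmodule ⊔ Submodule.span ℂ {AlgebraicLie.X₄ α β} =
      (AlgebraicLie.m α β).toSubmodule ∧
    Module.finrank ℂ (AlgebraicLie.m α β) = 4 ∧
    -- `m` is algebraic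
    AlgebraicLie.IsAlgebraic (AlgebraicLie.m α β) ∧
    -- `m = n₁ ⊕ a₁`
    (∃ n₁ a₁ : LieSubalgebra ℂ (Matrix (Fin 4) (Fin 4) ℂ),
      (∀ X, X ∈ n₁ ↔ X ∈ AlgebraicLie.m α β ∧ IsNilpotent X) ∧
      (∀ X, X ∈ a₁ ↔ X ∈ AlgebraicLie.m α β ∧ AlgebraicLie.IsSemisimple X) ∧
      Module.finrank ℂ n₁ = 3 ∧
      a₁.toSubmodule = Submodule.span ℂ {AlgebraicLie.X₄ α β} ∧
      (∀ X ∈ AlgebraicLie.m α β, ∀ Y ∈ n₁, ⁅X, Y⁆ ∈ n₁) ∧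
      (∀ X ∈ AlgebraicLie.m α β, ∀ Y ∈ a₁, ⁅X, Y⁆ = 0) ∧
      Disjoint n₁.toSubmodule a₁.toSubmodule ∧
      n₁.toSubmodule ⊔ a₁.toSubmodule = (AlgebraicLie.m α β).toSubmodule) ∧
    -- `m` is the smallest algebraic Lie algebra containing `h`
    IsLeast {L : LieSubalgebra ℂ (Matrix (Fin 4) (Fin 4) ℂ) |
      AlgebraicLie.IsAlgebraic L ∧ AlgebraicLie.h α β ≤ L} (AlgebraicLie.m α β) := by
  exact ⟨fun x₁ x₂ x₃ S N => AlgebraicLie.isJordanDecomposition_hMat_iff α β x₁ x₂ x₃ S N,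
    AlgebraicLie.disjoint_h_span_X₄ α β, rfl, AlgebraicLie.finrank_m α β,
    AlgebraicLie.isAlgebraic_of_mul_mem _ (AlgebraicLie.m_mul_mem α β),
    ⟨AlgebraicLie.nilIdeal, AlgebraicLie.X₄Line α β, fun X => AlgebraicLie.mem_nilIdeal_iff,
      fun X => AlgebraicLie.mem_X₄Line_iff, AlgebraicLie.finrank_nilIdeal, rfl,
      fun X hX Y hY => AlgebraicLie.lie_mem_nilIdeal hX hY,
      fun X hX Y hY => AlgebraicLie.lie_X₄Line hX hY,
      AlgebraicLie.disjoint_nilIdeal_X₄Line α β, AlgebraicLie.nilIdeal_sup_X₄Line α β⟩,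
    ⟨AlgebraicLie.isAlgebraic_of_mul_mem _ (AlgebraicLie.m_mul_mem α β),
      fun _ hX => le_sup_left (a := (AlgebraicLie.h α β).toSubmodule) hX⟩,
    fun L hL => AlgebraicLie.m_le_of_isAlgebraic hL.1 hL.2⟩
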